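/- Write $N(x)=\{z\in\mathbb Z^n : |x_i-z_i|<1\ (i=1,\dots,n)\}$ for the integral neighborhood of $x\in\mathbb R^n$. A nonempty set $S\subseteq\mathbb Z^n$ is called integrally convex if its convex hull equals the union, over all $x\in\mathbb R^n$, of the convex hulls of $S\cap N(x)$. For a function $f:\mathbb Z^n\to\mathbb R\cup\{+\infty\}$ let $\operatorname{dom} f=\{z\in\mathbb Z^n : f(z)<+\infty\}$, and let its local convex extension $\tilde f:\mathbb R^n\to\mathbb R\cup\{+\infty\}$ be $$\tilde f(x)=\min\Bigl\{\sum_{y\in N(x)}\lambda_y f(y) \;:\; \sum_{y\in N(x)}\lambda_y y=x,\ \sum_{y\in N(x)}\lambda_y=1,\ \lambda_y\ge 0\ (y\in N(x))\Bigr\}$$ (with $0\cdot(+\infty)=0$). The function $f$ is called integrally convex if $\tilde f$ is convex on $\mathbb R^n$. **Theorem 3.3.** Let $f:\mathbb Z^2\to\mathbb R\cup\{+\infty\}$ be a function with $\operatorname{dom} f\neq\emptyset$, and write $f_z(x)=f(z+x)$. Then $f$ is integrally convex if and only if $\operatorname{dom} f$ is an integrally convex set and, for every $z\in\operatorname{dom}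 f$, the five inequalities $$\begin{aligned} g(0,0)+g(2,1)&\ge g(1,1)+g(1,0),\\ g(0,0)+g(2,-1)&\ge g(1,-1)+g(1,0),\\ g(0,0)+g(2,0)&\ge 2g(1,0),\\ g(0,0)+g(2,2)&\ge 2g(1,1),\\ g(0,0)+g(2,-2)&\ge 2g(1,-1) \end{aligned}$$ are satisfied both by $g(x_1,x_2)=f_z(x_1,x_2)$ and by $g(x_1,x_2)=f_z(x_2,x_1)$. -/

import Mathlib

namespace IntegralConvexity

/-- The inclusion `ℤⁿ ⊆ ℝⁿ`. -/
def toReal {n : ℕ} (z : Fin n → ℤ) : Fin n → ℝ := fun i => (z i : ℝ)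

/-- The integral neighborhood `N(x)` of `x ∈ ℝⁿ`: the integer vectors `z` with
`⌊x i⌋ ≤ z i ≤ ⌈x i⌉` for all `i`; equivalently `|x i - z i| < 1` for all `i`,
see `mem_integralNeighborhood`. -/
noncomputable def integralNeighborhood {n : ℕ} (x : Fin n → ℝ) : Finset (Fin n → ℤ) :=
  Fintype.piFinset fun i => Finset.Icc ⌊x i⌋ ⌈x i⌉

theorem mem_integralNeighborhood {n : ℕ} (x : Fin n → ℝ) (z : Fin n → ℤ) :
    z ∈ integralNeighborhood x ↔ ∀ i, |x i - (z i : ℝ)| < 1 := by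
  simp only [integralNeighborhood, Fintype.mem_piFinset, Finset.mem_Icc, Int.floor_le_iff,
    Int.le_ceil_iff, abs_lt]
  refine forall_congr' fun i => ⟨fun h => ⟨by linarith [h.2], by linarith [h.1]⟩,
    fun h => ⟨by linarith [h.2], by linarith [h.1]⟩⟩

/-- A nonempty set `S ⊆ ℤⁿ` is integrally convex if its convex hull is the union over `x ∈ ℝⁿ`
of its local convex hulls, i.e. of the convex hulls of `S ∩ N(x)`. -/
def IsIntegrallyConvexSet {n : ℕ} (S : Set (Fin n → ℤ)) : Prop :=
  S.Nonempty ∧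
    convexHull ℝ (toReal '' S) =
      ⋃ x : Fin n → ℝ,
        convexHull ℝ (toReal '' (S ∩ (integralNeighborhood x : Set (Fin n → ℤ))))

/-- The effective domain of `f : ℤⁿ → ℝ ∪ {+∞}`. -/
def effectiveDomain {n : ℕ} (f : (Fin n → ℤ) → EReal) : Set (Fin n → ℤ) :=
  {z | f z < ⊤}

/-- The coefficients of the convex combinations of points of `N(x)` that represent `x`
(only the values on `N(x)` matter). -/
def localCoefficients {n : ℕ} (x : Fin n → ℝ) : Set ((Fin n → ℤ) → ℝ) :=
  {w | (∀ y ∈ integralNeighborhood x, 0 ≤ w y) ∧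
    ∑ y ∈ integralNeighborhood x, w y = 1 ∧
    ∑ y ∈ integralNeighborhood x, w y • toReal y = x}

/-- The local convex extension of `f : ℤⁿ → ℝ ∪ {+∞}`. The sums are taken in `EReal`, where
`0 * ⊤ = 0`. Since `N(x)` is finite, the infimum is a minimum. -/
noncomputable def localConvexExtension {n : ℕ} (f : (Fin n → ℤ) → EReal) :
    (Fin n → ℝ) → EReal :=
  fun x => ⨅ w ∈ localCoefficients x,
    ∑ y ∈ integralNeighborhood x, ((w y : ℝ) : EReal) * f y

/-- Convexity on all of `ℝⁿ` of a function with values in `ℝ ∪ {+∞}`. -/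
def IsConvexFun {n : ℕ} (g : (Fin n → ℝ) → EReal) : Prop :=
  ∀ (x y : Fin n → ℝ) (a b : ℝ), 0 < a → 0 < b → a + b = 1 →
    g (a • x + b • y) ≤ (a : EReal) * g x + (b : EReal) * g y

/-- `f : ℤⁿ → ℝ ∪ {+∞}` is integrally convex if its local convex extension is convex. -/
def IsIntegrallyConvexFun {n : ℕ} (f : (Fin n → ℤ) → EReal) : Prop :=
  IsConvexFun (localConvexExtension f)

/-- The shiftBy `f_z(x) = f (z + x)`. -/
def shiftBy {n : ℕ} (f : (Fin n → ℤ) → EReal) (z : Fin n → ℤ) : (Fin n → ℤ) → EReal :=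
  fun x => f (z + x)

/-- The function `(x₁, x₂) ↦ g (x₂, x₁)`. -/
def swapCoordinates (g : (Fin 2 → ℤ) → EReal) : (Fin 2 → ℤ) → EReal :=
  fun x => g ![x 1, x 0]

/-- The five inequalities for a function `g` on `ℤ²`. -/
def FiveInequalities (g : (Fin 2 → ℤ) → EReal) : Prop :=
  g ![0, 0] + g ![2, 1] ≥ g ![1, 1] + g ![1, 0] ∧
  g ![0, 0] + g ![2, -1] ≥ g ![1, -1] + g ![1, 0] ∧
  g ![0, 0] + g ![2, 0] ≥ 2 * g ![1, 0] ∧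
  g ![0, 0] + g ![2, 2] ≥ 2 * g ![1, 1] ∧
  g ![0, 0] + g ![2, -2] ≥ 2 * g ![1, -1]

end IntegralConvexity

/-! If f̃ is convex, evaluate it at the midpoint of two domain points y, y'. At a lattice point f̃
equals f, and at the midpoint of a unit edge the local coefficients are forced to be 1/2, 1/2. Each
of the five inequalities is one of these two cases. The domain is integrally convex because {f̃ < ⊤}
is convex and contains it, and f̃(x) < ⊤ means that x is a combination of domain points in N(x).

Conversely, let y, y' be domain points at ℓ∞-distance at least 2. With u the signed unit vector of a
dominant coordinate of y' - y and v that of the other one, the pair can be replaced by y + s, y' -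
s, where s = u, or s = u + v when y' - y is diagonal, without raising the sum of values. For
differences 2u, 2u + v and 2(u + v) these are the five inequalities up to symmetry; longer
differences follow by induction (`exchangeLE_step`, `exchangeLE_step_diagonal`). Integral convexity
of the domain enters through `IsIntegrallyConvexSet.edge_mem`, which keeps the intermediate points
in the domain.

Given such exchanges, mix nearly optimal weights for f̃ at two points. Among all weights with the
same barycenter and no larger cost, take one of least second moment. An exchange would strictly
decrease the second moment, so the support lies in a unit box, hence in N of the barycenter, and the
weights compete in the definition of f̃ there. This is `exists_convexCombination_supported_in_box`,
used in `isIntegrallyConvexFun_of_exchange`. -/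

namespace IntegralConvexity

/-! ### Exchanges over long differences -/

/-- Passing from the pair `y, y'` to the pair `p, q` stays inside `S` and does not increase `F`. -/
def ExchangeLE {G : Type*} (S : Set G) (F : G → ℝ) (y y' p q : G) : Prop :=
  y ∈ S → y' ∈ S → p ∈ S ∧ q ∈ S ∧ F p + F q ≤ F y + F y'

/-- Telescoping: the long exchange for a pair starting at y + u (or y + u + v) has a shorter
difference and produces y + 2u (or y + 2u + v). Adding the short inequality `h₁` (or `h₂`) at y
cancels the auxiliary values. The hypotheses `d₁`, `d₂` supply the starting point of the shorter
pair. -/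
theorem exchangeLE_step {G : Type*} [AddCommGroup G] {S : Set G} {F : G → ℝ} {u v : G}
    (h₁ : ∀ y, ExchangeLE S F y (y + 2 • u) (y + u) (y + u))
    (h₂ : ∀ y, ExchangeLE S F y (y + 2 • u + v) (y + u) (y + u + v))
    (d₁ : ∀ y (m k : ℕ), k < m → y ∈ S → y + m • u + k • v ∈ S → y + u ∈ S)
    (d₂ : ∀ y (m k : ℕ), 0 < k → k ≤ m → y ∈ S → y + m • u + k • v ∈ S → y + u + v ∈ S) :
    ∀ (m k : ℕ) (y : G), k ≤ m + 1 →
      ExchangeLE S F y (y + (m + 2) • u + k • v) (y + u) (y + (m + 1) • u + k • v) := by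
  intro m
  induction m with
  | zero =>
    intro k y hk
    obtain rfl | rfl : k = 0 ∨ k = 1 := by omega
    · simpa using h₁ y
    · simpa using h₂ y
  | succ m ih =>
    intro k y hk hy hy'
    have hu := d₁ y _ _ (by omega) hy hy'
    -- In the extreme case k = m + 2, starting from y + u would leave a diagonal difference, outside
    -- the range of the induction; starting from y + u + v lowers both multiplicities.
    rcases Nat.lt_or_ge (m + 1) k with hkm | hkm
    · obtain ⟨l, rfl⟩ : ∃ l, k = l + 1 := ⟨k - 1, by omega⟩
      have huv := d₂ y _ _ (by omega) (by omega) hy hy'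
      have e₁ : y + u + v + (m + 2) • u + l • v = y + (m + 1 + 2) • u + (l + 1) • v := by module
      have e₂ : y + u + v + u = y + 2 • u + v := by module
      have e₃ : y + u + v + (m + 1) • u + l • v = y + (m + 1 + 1) • u + (l + 1) • v := by module
      have h := ih l (y + u + v) (by omega)
      rw [e₁, e₂, e₃] at h
      obtain ⟨ha, hb, hab⟩ := h huv hy'
      obtain ⟨-, -, hcd⟩ := h₂ y hy ha
      exact ⟨hu, hb, by linarith⟩
    · have e₁ : y + u + (m + 2) • u + k • v = y + (m + 1 + 2) • u + k • v := by module
      have e₂ : y + u + u = y + 2 • u := by module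
      have e₃ : y + u + (m + 1) • u + k • v = y + (m + 1 + 1) • u + k • v := by module
      have h := ih k (y + u) hkm
      rw [e₁, e₂, e₃] at h
      obtain ⟨ha, hb, hab⟩ := h hu hy'
      obtain ⟨-, -, hcd⟩ := h₁ y hy ha
      exact ⟨hu, hb, by linarith⟩

theorem exchangeLE_step_diagonal {G : Type*} [AddCommGroup G] {S : Set G} {F : G → ℝ} {e : G}
    (h : ∀ y, ExchangeLE S F y (y + 2 • e) (y + e) (y + e))
    (d : ∀ y (m : ℕ), 0 < m → y ∈ S → y + m • e ∈ S → y + e ∈ S) (m : ℕ) (y : G) :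
    ExchangeLE S F y (y + (m + 2) • e) (y + e) (y + (m + 1) • e) := by
  have := exchangeLE_step (u := e) (v := 0) h
    (fun y hy hy' => by simpa using h y hy (by simpa using hy'))
    (fun y m k hk hy hy' => d y m (by omega) hy (by simpa using hy'))
    (fun y m k hk hkm hy hy' => by simpa using d y m (by omega) hy (by simpa using hy'))
    m 0 y (by omega)
  simpa using this

/-! ### Convex combinations supported in a unit box -/

/-- The squared Euclidean norm of an integer vector. -/
def sqNorm {n : ℕ} (y : Fin n → ℤ) : ℤ := ∑ i, y i ^ 2

/-- A convex combination of points of `T` can be replaced by one of no larger cost whose support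
is contained in a unit box, if distant pairs of points of `T` can be brought closer. -/
theorem exists_convexCombination_supported_in_box {n : ℕ} {T : Finset (Fin n → ℤ)}
    {F : (Fin n → ℤ) → ℝ}
    (hT : ∀ y ∈ T, ∀ y' ∈ T, (∃ i, 2 ≤ |y i - y' i|) →
      ∃ p ∈ T, ∃ q ∈ T, p + q = y + y' ∧ F p + F q ≤ F y + F y' ∧
        sqNorm p + sqNorm q < sqNorm y + sqNorm y')
    {w : (Fin n → ℤ) → ℝ} (hw₀ : ∀ y, 0 ≤ w y) (hwT : ∀ y ∉ T, w y = 0) (hw₁ : ∑ y ∈ T, w y = 1) :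
    ∃ μ : (Fin n → ℤ) → ℝ, (∀ y, 0 ≤ μ y) ∧ (∀ y ∉ T, μ y = 0) ∧ ∑ y ∈ T, μ y = 1 ∧
      ∑ y ∈ T, μ y • toReal y = ∑ y ∈ T, w y • toReal y ∧
      ∑ y ∈ T, μ y * F y ≤ ∑ y ∈ T, w y * F y ∧
      ∀ y y', μ y ≠ 0 → μ y' ≠ 0 → ∀ i, |y i - y' i| ≤ 1 := by
  classical
  -- The ambient product has infinitely many factors, but each factor is a compact interval, equal
  -- to {0} off T, so Tychonoff applies.
  let K : Set ((Fin n → ℤ) → ℝ) :=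
    Set.univ.pi (fun y => Set.Icc 0 (if y ∈ T then 1 else 0)) ∩
      {μ | ∑ y ∈ T, μ y = 1 ∧ ∑ y ∈ T, μ y • toReal y = ∑ y ∈ T, w y • toReal y ∧
        ∑ y ∈ T, μ y * F y ≤ ∑ y ∈ T, w y * F y}
  have hbound : ∀ μ : (Fin n → ℤ) → ℝ, (∀ y, 0 ≤ μ y) → (∀ y ∉ T, μ y = 0) → ∑ y ∈ T, μ y = 1 →
      μ ∈ Set.univ.pi (fun y => Set.Icc (0 : ℝ) (if y ∈ T then 1 else 0)) := by
    intro μ h₀ hz h₁ y _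
    refine ⟨h₀ y, ?_⟩
    split_ifs with hy
    · rw [← h₁]
      exact Finset.single_le_sum (fun z _ => h₀ z) hy
    · exact (hz y hy).le
  have hKc : IsCompact K := by
    refine (isCompact_univ_pi fun y => isCompact_Icc).inter_right ?_
    have c₁ : IsClosed {μ : (Fin n → ℤ) → ℝ | ∑ y ∈ T, μ y = 1} :=
      isClosed_eq (by fun_prop) (by fun_prop)
    have c₂ : IsClosed {μ : (Fin n → ℤ) → ℝ |
        ∑ y ∈ T, μ y • toReal y = ∑ y ∈ T, w y • toReal y} :=
      isClosed_eq (by fun_prop) (by fun_prop)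
    have c₃ : IsClosed {μ : (Fin n → ℤ) → ℝ | ∑ y ∈ T, μ y * F y ≤ ∑ y ∈ T, w y * F y} :=
      isClosed_le (by fun_prop) (by fun_prop)
    exact c₁.inter (c₂.inter c₃)
  obtain ⟨μ, hμK, hmin⟩ := hKc.exists_isMinOn (f := fun μ => ∑ y ∈ T, μ y * (sqNorm y : ℝ))
    ⟨w, hbound w hw₀ hwT hw₁, hw₁, rfl, le_rfl⟩ (by fun_prop)
  obtain ⟨hbox, hμ₁, hμx, hμF⟩ := hμK
  have hμ₀ : ∀ y, 0 ≤ μ y := fun y => (hbox y trivial).1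
  have hμT : ∀ y ∉ T, μ y = 0 := fun y hy => by
    have := hbox y trivial
    simp only [hy, if_false, Set.Icc_self, Set.mem_singleton_iff] at this
    exact this
  refine ⟨μ, hμ₀, hμT, hμ₁, hμx, hμF, fun y y' hy hy' => ?_⟩
  by_contra! hfar
  obtain ⟨i, hi⟩ := hfar
  have hyT : y ∈ T := by_contra fun h => hy (hμT y h)
  have hyT' : y' ∈ T := by_contra fun h => hy' (hμT y' h)
  obtain ⟨p, hp, q, hq, hsum, hF, hQ⟩ := hT y hyT y' hyT' ⟨i, hi⟩
  have hne : y ≠ y' := by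
    rintro rfl
    simp at hi
  -- The largest mass that can leave both y and y'; it is moved to p and q, which may coincide.
  set t := min (μ y) (μ y') with ht
  have htpos : 0 < t := lt_min ((hμ₀ y).lt_of_ne' hy) ((hμ₀ y').lt_of_ne' hy')
  let ν : (Fin n → ℤ) → ℝ := fun z =>
    μ z + t * ((if z = p then 1 else 0) + (if z = q then 1 else 0)
      - (if z = y then 1 else 0) - (if z = y' then 1 else 0))
  have hνsum : ∀ g : (Fin n → ℤ) → ℝ,
      ∑ z ∈ T, ν z * g z = ∑ z ∈ T, μ z * g z + t * (g p + g q - g y - g y') := by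
    intro g
    simp only [ν, add_mul, mul_assoc, sub_mul, Finset.sum_add_distrib, ← Finset.mul_sum,
      Finset.sum_sub_distrib, ite_mul, one_mul, zero_mul, Finset.sum_ite_eq', hp, hq, hyT, hyT',
      if_true]
  have hν₀ : ∀ z, 0 ≤ ν z := by
    intro z
    have h₁ : 0 ≤ t * ((if z = p then 1 else 0) + (if z = q then 1 else 0)) := by positivity
    have h₂ : t * ((if z = y then 1 else 0) + (if z = y' then 1 else 0)) ≤ μ z := by
      by_cases hzy : z = y
      · subst hzy
        simp [hne, ht]
      · by_cases hzy' : z = y'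
        · subst hzy'
          simp [hzy, ht]
        · simpa [hzy, hzy'] using hμ₀ z
    simp only [ν]
    linarith
  have hνT : ∀ z ∉ T, ν z = 0 := by
    intro z hz
    have hzp : z ≠ p := fun h => hz (h ▸ hp)
    have hzq : z ≠ q := fun h => hz (h ▸ hq)
    have hzy : z ≠ y := fun h => hz (h ▸ hyT)
    have hzy' : z ≠ y' := fun h => hz (h ▸ hyT')
    simp [ν, hzp, hzq, hzy, hzy', hμT z hz]
  have hν₁ : ∑ z ∈ T, ν z = 1 := by
    have := hνsum fun _ => 1
    simp only [mul_one] at this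
    rw [this, hμ₁]
    ring
  have hνx : ∑ z ∈ T, ν z • toReal z = ∑ z ∈ T, w z • toReal z := by
    rw [← hμx]
    ext j
    have h := hνsum fun z => toReal z j
    have hj : (p j + q j : ℝ) = y j + y' j := by exact_mod_cast congrFun hsum j
    simp only [Finset.sum_apply, Pi.smul_apply, smul_eq_mul]
    rw [h]
    simp only [toReal]
    linear_combination t * hj
  have hνF : ∑ z ∈ T, ν z * F z ≤ ∑ z ∈ T, w z * F z := by
    rw [hνsum]
    nlinarith
  have hle := hmin (a := ν) ⟨hbound ν hν₀ hνT hν₁, hν₁, hνx, hνF⟩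
  simp only [Set.mem_ofPred_eq] at hle
  rw [hνsum] at hle
  have hQ' : (sqNorm p + sqNorm q : ℝ) < sqNorm y + sqNorm y' := by exact_mod_cast hQ
  nlinarith

theorem sum_eq_sum_of_support {ι M : Type*} [AddCommMonoid M] {A B : Finset ι} {g : ι → M}
    (hA : ∀ i, g i ≠ 0 → i ∈ A) (hB : ∀ i, g i ≠ 0 → i ∈ B) :
    ∑ i ∈ A, g i = ∑ i ∈ B, g i := by
  classical
  have h : ∀ C : Finset ι, (∀ i, g i ≠ 0 → i ∈ C) → ∑ i ∈ A ∩ B, g i = ∑ i ∈ A ∩ B ∩ C, g i :=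
    fun C hC => (Finset.sum_subset Finset.inter_subset_left fun i hi hi' => by
      by_contra hg
      exact hi' (Finset.mem_inter.2 ⟨hi, hC i hg⟩)).symm
  trans ∑ i ∈ A ∩ B, g i
  · exact (Finset.sum_subset Finset.inter_subset_left fun i _ hi => by
      by_contra hg
      exact hi (Finset.mem_inter.2 ⟨hA i hg, hB i hg⟩)).symm
  · exact Finset.sum_subset Finset.inter_subset_right fun i _ hi => by
      by_contra hg
      exact hi (Finset.mem_inter.2 ⟨hA i hg, hB i hg⟩)

/-- In a convex combination supported in a unit box, the support lies in the integral
neighborhood of the point represented. -/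
theorem mem_integralNeighborhood_of_supported_in_box {n : ℕ} {T : Finset (Fin n → ℤ)}
    {μ : (Fin n → ℤ) → ℝ} (h₀ : ∀ y, 0 ≤ μ y) (hT : ∀ y ∉ T, μ y = 0) (h₁ : ∑ y ∈ T, μ y = 1)
    (hbox : ∀ y y', μ y ≠ 0 → μ y' ≠ 0 → ∀ i, |y i - y' i| ≤ 1)
    {y : Fin n → ℤ} (hy : μ y ≠ 0) :
    y ∈ integralNeighborhood (∑ y ∈ T, μ y • toReal y) := by
  classical
  rw [mem_integralNeighborhood]
  intro i
  have hyT : y ∈ T := by_contra fun h => hy (hT y h)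
  have hx : (∑ z ∈ T, μ z • toReal z) i - (y i : ℝ) = ∑ z ∈ T, μ z * ((z i : ℝ) - y i) := by
    simp only [Finset.sum_apply, Pi.smul_apply, smul_eq_mul, toReal, mul_sub,
      Finset.sum_sub_distrib, ← Finset.sum_mul, h₁, one_mul]
  rw [hx]
  calc |∑ z ∈ T, μ z * ((z i : ℝ) - y i)| ≤ ∑ z ∈ T, |μ z * ((z i : ℝ) - y i)| :=
        Finset.abs_sum_le_sum_abs _ _
    _ < ∑ z ∈ T, μ z := by
        -- Strictness comes from the term z = y, which is 0 on the left and μ y > 0 on the right.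
        refine Finset.sum_lt_sum (fun z _ => ?_) ⟨y, hyT, by simpa using (h₀ y).lt_of_ne' hy⟩
        rw [abs_mul, abs_of_nonneg (h₀ z)]
        rcases eq_or_ne (μ z) 0 with hz | hz
        · simp [hz]
        · have : |(z i : ℝ) - y i| ≤ 1 := by exact_mod_cast hbox z y hz hy i
          exact mul_le_of_le_one_right (h₀ z) this
    _ = 1 := h₁

theorem mem_localCoefficients_of_supported_in_box {n : ℕ} {T : Finset (Fin n → ℤ)}
    {μ : (Fin n → ℤ) → ℝ} (h₀ : ∀ y, 0 ≤ μ y) (hT : ∀ y ∉ T, μ y = 0) (h₁ : ∑ y ∈ T, μ y = 1)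
    (hbox : ∀ y y', μ y ≠ 0 → μ y' ≠ 0 → ∀ i, |y i - y' i| ≤ 1) :
    μ ∈ localCoefficients (∑ y ∈ T, μ y • toReal y) := by
  have hN := fun y => mem_integralNeighborhood_of_supported_in_box h₀ hT h₁ hbox (y := y)
  have hT' : ∀ y, μ y ≠ 0 → y ∈ T := fun y hy => by_contra fun h => hy (hT y h)
  refine ⟨fun y _ => h₀ y, ?_, ?_⟩
  · rw [← h₁]
    exact sum_eq_sum_of_support hN hT'
  · exact sum_eq_sum_of_support (fun y hy => hN y (left_ne_zero_of_smul hy))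
      (fun y hy => hT' y (left_ne_zero_of_smul hy))

/-! ### Sums in `EReal` -/

theorem EReal_coe_sum {ι : Type*} (A : Finset ι) (g : ι → ℝ) :
    ((∑ i ∈ A, g i : ℝ) : EReal) = ∑ i ∈ A, (g i : EReal) := by
  classical
  induction A using Finset.induction_on with
  | empty => simp
  | insert i A hi ih => rw [Finset.sum_insert hi, Finset.sum_insert hi, EReal.coe_add, ih]

theorem EReal_two_mul (x : EReal) : 2 * x = x + x := by
  have h2 : (2 : EReal) = ((2 : ℝ) : EReal) := rfl
  induction x with
  | bot => rw [h2, EReal.coe_mul_bot_of_pos (by norm_num)]; rfl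
  | top => rw [h2, EReal.coe_mul_top_of_pos (by norm_num)]; rfl
  | coe x => rw [h2, ← EReal.coe_mul, ← EReal.coe_add, two_mul]

theorem sum_coe_mul_eq_coe {ι : Type*} {A : Finset ι} {w : ι → ℝ} {f : ι → EReal}
    (hbot : ∀ i, f i ≠ ⊥) (h : ∀ i ∈ A, w i ≠ 0 → f i < ⊤) :
    ∑ i ∈ A, (w i : EReal) * f i = ((∑ i ∈ A, w i * (f i).toReal : ℝ) : EReal) := by
  rw [EReal_coe_sum]
  refine Finset.sum_congr rfl fun i hi => ?_
  rcases eq_or_ne (w i) 0 with hw | hw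
  · simp [hw]
  · rw [EReal.coe_mul, EReal.coe_toReal (h i hi hw).ne (hbot i)]

theorem coe_mul_ne_bot {a : ℝ} {x : EReal} (ha : 0 ≤ a) (hx : x ≠ ⊥) : (a : EReal) * x ≠ ⊥ := by
  rw [EReal.mul_ne_bot]
  exact ⟨Or.inl (EReal.coe_ne_bot a), Or.inr hx, Or.inl (EReal.coe_ne_top a),
    Or.inl (EReal.coe_nonneg.2 ha)⟩

theorem lt_top_of_sum_coe_mul_lt_top {ι : Type*} {A : Finset ι} {w : ι → ℝ} {f : ι → EReal}
    (hbot : ∀ i, f i ≠ ⊥) (hw : ∀ i ∈ A, 0 ≤ w i) (h : ∑ i ∈ A, (w i : EReal) * f i < ⊤) :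
    ∀ i ∈ A, w i ≠ 0 → f i < ⊤ := by
  classical
  intro i hi hwi
  by_contra hf
  have hrest : ∑ j ∈ A.erase i, (w j : EReal) * f j ≠ ⊥ := by
    refine Finset.sum_induction _ (· ≠ ⊥) (fun a b ha hb => EReal.add_ne_bot_iff.2 ⟨ha, hb⟩)
      (by simp) fun j hj => coe_mul_ne_bot (hw j (Finset.mem_of_mem_erase hj)) (hbot j)
  rw [← Finset.add_sum_erase A _ hi, not_lt_top_iff.1 hf,
    EReal.coe_mul_top_of_pos ((hw i hi).lt_of_ne' hwi), EReal.top_add_of_ne_bot hrest] at h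
  exact lt_irrefl _ h

/-! ### The local convex extension -/

variable {n : ℕ}

/-- An infimum below c has a competitor below c. Its weights are cut off outside N(x), where
`localCoefficients` says nothing about them. -/
theorem exists_weights_of_localConvexExtension_lt {f : (Fin n → ℤ) → EReal}
    (hbot : ∀ z, f z ≠ ⊥) {x : Fin n → ℝ} {c : EReal} (h : localConvexExtension f x < c) :
    ∃ w : (Fin n → ℤ) → ℝ, (∀ y, 0 ≤ w y) ∧
      (∀ y, w y ≠ 0 → y ∈ integralNeighborhood x ∧ y ∈ effectiveDomain f) ∧
      ∑ y ∈ integralNeighborhood x, w y = 1 ∧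
      ∑ y ∈ integralNeighborhood x, w y • toReal y = x ∧
      ((∑ y ∈ integralNeighborhood x, w y * (f y).toReal : ℝ) : EReal) < c := by
  classical
  obtain ⟨w, ⟨h₀, h₁, hx⟩, hc⟩ : ∃ w, ∃ _ : w ∈ localCoefficients x,
      ∑ y ∈ integralNeighborhood x, ((w y : ℝ) : EReal) * f y < c := by
    simpa only [localConvexExtension, iInf_lt_iff] using h
  have hfin := lt_top_of_sum_coe_mul_lt_top hbot h₀ (hc.trans_le le_top)
  rw [sum_coe_mul_eq_coe hbot hfin] at hc
  have hcongr : ∀ y ∈ integralNeighborhood x,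
      (if y ∈ integralNeighborhood x then w y else 0) = w y := fun y hy => if_pos hy
  refine ⟨fun y => if y ∈ integralNeighborhood x then w y else 0, fun y => ?_, fun y hy => ?_,
    ?_, ?_, ?_⟩
  · beta_reduce
    split_ifs with hy
    · exact h₀ y hy
    · exact le_rfl
  · have hyN : y ∈ integralNeighborhood x := by_contra fun h => hy (if_neg h)
    exact ⟨hyN, hfin y hyN (by simpa [hyN] using hy)⟩
  · rw [← h₁]
    exact Finset.sum_congr rfl hcongr
  · conv_rhs => rw [← hx]
    exact Finset.sum_congr rfl fun y hy => by beta_reduce; rw [hcongr y hy]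
  · refine lt_of_eq_of_lt ?_ hc
    rw [EReal.coe_eq_coe_iff]
    exact Finset.sum_congr rfl fun y hy => by beta_reduce; rw [hcongr y hy]

theorem localConvexExtension_le {f : (Fin n → ℤ) → EReal} (hbot : ∀ z, f z ≠ ⊥) {x : Fin n → ℝ}
    {w : (Fin n → ℤ) → ℝ} (hw : w ∈ localCoefficients x)
    (hfin : ∀ y ∈ integralNeighborhood x, w y ≠ 0 → y ∈ effectiveDomain f) :
    localConvexExtension f x ≤
      ((∑ y ∈ integralNeighborhood x, w y * (f y).toReal : ℝ) : EReal) := by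
  rw [← sum_coe_mul_eq_coe hbot hfin]
  exact iInf₂_le w hw

/-- N(x) is finite, so the real parts of f have a lower bound M there, and every finite convex
combination is at least M. Points where f is ⊤ have real part 0, which can only lower M. -/
theorem localConvexExtension_ne_bot {f : (Fin n → ℤ) → EReal} (hbot : ∀ z, f z ≠ ⊥)
    (x : Fin n → ℝ) : localConvexExtension f x ≠ ⊥ := by
  classical
  obtain ⟨M, hM⟩ := ((integralNeighborhood x).image fun y => (f y).toReal).bddBelow
  have hM' : ∀ y ∈ integralNeighborhood x, M ≤ (f y).toReal := fun y hy =>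
    hM (Finset.mem_coe.2 (Finset.mem_image_of_mem _ hy))
  refine ne_bot_of_le_ne_bot (EReal.coe_ne_bot M) (le_iInf₂ fun w hw => ?_)
  rcases eq_or_ne (∑ y ∈ integralNeighborhood x, ((w y : ℝ) : EReal) * f y) ⊤ with h | h
  · rw [h]
    exact le_top
  · rw [sum_coe_mul_eq_coe hbot (lt_top_of_sum_coe_mul_lt_top hbot hw.1 h.lt_top),
      EReal.coe_le_coe_iff, ← one_mul M, ← hw.2.1, Finset.sum_mul]
    exact Finset.sum_le_sum fun y hy => mul_le_mul_of_nonneg_left (hM' y hy) (hw.1 y hy)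

/-! ### Exchange implies integral convexity -/

/-- A function is integrally convex if pairs of distant points of its domain can be brought
closer to each other, inside the box they span, without increasing the sum of the values. -/
theorem isIntegrallyConvexFun_of_exchange {f : (Fin n → ℤ) → EReal} (hbot : ∀ z, f z ≠ ⊥)
    (hf : ∀ y y', (∃ i, 2 ≤ |y i - y' i|) → y ∈ effectiveDomain f → y' ∈ effectiveDomain f →
      ∃ p ∈ Finset.uIcc y y', ∃ q ∈ Finset.uIcc y y', p + q = y + y' ∧
        sqNorm p + sqNorm q < sqNorm y + sqNorm y' ∧
        p ∈ effectiveDomain f ∧ q ∈ effectiveDomain f ∧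
        (f p).toReal + (f q).toReal ≤ (f y).toReal + (f y').toReal) :
    IsIntegrallyConvexFun f := by
  classical
  intro x₁ x₂ a b ha hb hab
  rcases eq_or_ne (localConvexExtension f x₁) ⊤ with ht₁ | ht₁
  · rw [ht₁, EReal.coe_mul_top_of_pos ha, EReal.top_add_of_ne_bot
      (coe_mul_ne_bot hb.le (localConvexExtension_ne_bot hbot x₂))]
    exact le_top
  rcases eq_or_ne (localConvexExtension f x₂) ⊤ with ht₂ | ht₂
  · rw [ht₂, EReal.coe_mul_top_of_pos hb, EReal.add_top_of_ne_bot
      (coe_mul_ne_bot ha.le (localConvexExtension_ne_bot hbot x₁))]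
    exact le_top
  obtain ⟨P₁, hP₁⟩ : ∃ P : ℝ, localConvexExtension f x₁ = P :=
    ⟨_, (EReal.coe_toReal ht₁ (localConvexExtension_ne_bot hbot x₁)).symm⟩
  obtain ⟨P₂, hP₂⟩ : ∃ P : ℝ, localConvexExtension f x₂ = P :=
    ⟨_, (EReal.coe_toReal ht₂ (localConvexExtension_ne_bot hbot x₂)).symm⟩
  refine EReal.le_of_forall_lt_iff_le.1 fun c hc => ?_
  rw [hP₁, hP₂, ← EReal.coe_mul, ← EReal.coe_mul, ← EReal.coe_add, EReal.coe_lt_coe_iff] at hc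
  -- Near-optimal weights suffice: an error ε at both points averages to ε, since a + b = 1.
  set ε := c - (a * P₁ + b * P₂) with hε
  have hεpos : 0 < ε := by linarith
  obtain ⟨w₁, h₁₀, h₁s, h₁₁, h₁x, h₁c⟩ := exists_weights_of_localConvexExtension_lt hbot
    (x := x₁) (c := ((P₁ + ε : ℝ) : EReal)) (by rw [hP₁, EReal.coe_lt_coe_iff]; linarith)
  obtain ⟨w₂, h₂₀, h₂s, h₂₁, h₂x, h₂c⟩ := exists_weights_of_localConvexExtension_lt hbot
    (x := x₂) (c := ((P₂ + ε : ℝ) : EReal)) (by rw [hP₂, EReal.coe_lt_coe_iff]; linarith)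
  rw [EReal.coe_lt_coe_iff] at h₁c h₂c
  obtain ⟨lo, hlo⟩ := (integralNeighborhood x₁ ∪ integralNeighborhood x₂).bddBelow
  obtain ⟨hi, hhi⟩ := (integralNeighborhood x₁ ∪ integralNeighborhood x₂).bddAbove
  -- A full box, not just the union of the two neighborhoods: exchanged points lie in the box
  -- spanned by the old pair, so T is closed under exchange.
  set T := (Finset.Icc lo hi).filter (· ∈ effectiveDomain f) with hTdef
  have h₁T : ∀ y, w₁ y ≠ 0 → y ∈ T := fun y hy => by
    have hy' := Finset.mem_coe.2
      (Finset.mem_union_left (integralNeighborhood x₂) (h₁s y hy).1)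
    exact Finset.mem_filter.2 ⟨Finset.mem_Icc.2 ⟨hlo hy', hhi hy'⟩, (h₁s y hy).2⟩
  have h₂T : ∀ y, w₂ y ≠ 0 → y ∈ T := fun y hy => by
    have hy' := Finset.mem_coe.2
      (Finset.mem_union_right (integralNeighborhood x₁) (h₂s y hy).1)
    exact Finset.mem_filter.2 ⟨Finset.mem_Icc.2 ⟨hlo hy', hhi hy'⟩, (h₂s y hy).2⟩
  rw [sum_eq_sum_of_support (fun y hy => (h₁s y hy).1) h₁T] at h₁₁
  rw [sum_eq_sum_of_support (fun y hy => (h₂s y hy).1) h₂T] at h₂₁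
  rw [sum_eq_sum_of_support (fun y hy => (h₁s y (left_ne_zero_of_smul hy)).1)
    (fun y hy => h₁T y (left_ne_zero_of_smul hy))] at h₁x
  rw [sum_eq_sum_of_support (fun y hy => (h₂s y (left_ne_zero_of_smul hy)).1)
    (fun y hy => h₂T y (left_ne_zero_of_smul hy))] at h₂x
  rw [sum_eq_sum_of_support (fun y hy => (h₁s y (left_ne_zero_of_mul hy)).1)
    (fun y hy => h₁T y (left_ne_zero_of_mul hy))] at h₁c
  rw [sum_eq_sum_of_support (fun y hy => (h₂s y (left_ne_zero_of_mul hy)).1)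
    (fun y hy => h₂T y (left_ne_zero_of_mul hy))] at h₂c
  obtain ⟨μ, hμ₀, hμT, hμ₁, hμx, hμF, hμbox⟩ :=
    exists_convexCombination_supported_in_box (T := T) (F := fun y => (f y).toReal)
      (w := fun y => a * w₁ y + b * w₂ y) (by
        intro y hy y' hy' hfar
        obtain ⟨hyI, hyS⟩ := Finset.mem_filter.1 hy
        obtain ⟨hyI', hyS'⟩ := Finset.mem_filter.1 hy'
        obtain ⟨p, hp, q, hq, hsum, hQ, hpS, hqS, hF⟩ := hf y y' hfar hyS hyS'
        have hsub := Finset.uIcc_subset_Icc hyI hyI'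
        exact ⟨p, Finset.mem_filter.2 ⟨hsub hp, hpS⟩, q, Finset.mem_filter.2 ⟨hsub hq, hqS⟩,
          hsum, hF, hQ⟩)
      (fun y => by have := h₁₀ y; have := h₂₀ y; positivity)
      (fun y hy => by
        have e₁ : w₁ y = 0 := by_contra fun h => hy (h₁T y h)
        have e₂ : w₂ y = 0 := by_contra fun h => hy (h₂T y h)
        simp [e₁, e₂])
      (by rw [Finset.sum_add_distrib, ← Finset.mul_sum, ← Finset.mul_sum, h₁₁, h₂₁]; linarith)
  have hx : ∑ y ∈ T, μ y • toReal y = a • x₁ + b • x₂ := by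
    rw [hμx, ← h₁x, ← h₂x, Finset.smul_sum, Finset.smul_sum, ← Finset.sum_add_distrib]
    exact Finset.sum_congr rfl fun y _ => by rw [add_smul, mul_smul, mul_smul]
  have hcost : ∑ y ∈ T, (a * w₁ y + b * w₂ y) * (f y).toReal =
      a * ∑ y ∈ T, w₁ y * (f y).toReal + b * ∑ y ∈ T, w₂ y * (f y).toReal := by
    rw [Finset.mul_sum, Finset.mul_sum, ← Finset.sum_add_distrib]
    exact Finset.sum_congr rfl fun y _ => by ring
  have hμT' : ∀ y, μ y ≠ 0 → y ∈ T := fun y hy => by_contra fun h => hy (hμT y h)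
  have hμN := fun y => mem_integralNeighborhood_of_supported_in_box hμ₀ hμT hμ₁ hμbox (y := y)
  have hμ := mem_localCoefficients_of_supported_in_box hμ₀ hμT hμ₁ hμbox
  rw [hx] at hμ hμN
  refine (localConvexExtension_le hbot hμ fun y _ hy => (Finset.mem_filter.1 (hμT' y hy)).2).trans ?_
  rw [EReal.coe_le_coe_iff, sum_eq_sum_of_support (fun y hy => hμN y (left_ne_zero_of_mul hy))
    (fun y hy => hμT' y (left_ne_zero_of_mul hy))]
  have i₁ := mul_lt_mul_of_pos_left h₁c ha
  have i₂ := mul_lt_mul_of_pos_left h₂c hb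
  have i₃ : a * ε + b * ε = ε := by rw [← add_mul, hab, one_mul]
  linarith

/-! ### Integral convexity of the domain -/

/-- Every point of the convex hull of an integrally convex set is represented locally. -/
theorem IsIntegrallyConvexSet.exists_localCoefficients {S : Set (Fin n → ℤ)}
    (hS : IsIntegrallyConvexSet S) {x : Fin n → ℝ} (hx : x ∈ convexHull ℝ (toReal '' S)) :
    ∃ w ∈ localCoefficients x, ∀ y, w y ≠ 0 → y ∈ S := by
  classical
  rw [hS.2, Set.mem_iUnion] at hx
  obtain ⟨x', hx'⟩ := hx
  set T := (integralNeighborhood x').filter (· ∈ S) with hTdef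
  have hsub : convexHull ℝ (toReal '' (S ∩ (integralNeighborhood x' : Set (Fin n → ℤ)))) ⊆
      {p | ∃ μ : (Fin n → ℤ) → ℝ, (∀ y, 0 ≤ μ y) ∧ (∀ y ∉ T, μ y = 0) ∧ ∑ y ∈ T, μ y = 1 ∧
        ∑ y ∈ T, μ y • toReal y = p} := by
    refine convexHull_min ?_ ?_
    · rintro _ ⟨y, ⟨hyS, hyN⟩, rfl⟩
      have hyT : y ∈ T := Finset.mem_filter.2 ⟨hyN, hyS⟩
      refine ⟨fun z => if z = y then 1 else 0, fun z => by positivity, fun z hz => ?_, ?_, ?_⟩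
      · exact if_neg fun h : z = y => hz (h ▸ hyT)
      · simp [hyT]
      · simp [hyT]
    · rintro p ⟨μ, h₀, hT, h₁, rfl⟩ q ⟨ν, k₀, kT, k₁, rfl⟩ a b ha hb hab
      refine ⟨fun y => a * μ y + b * ν y, fun y => ?_, fun y hy => ?_, ?_, ?_⟩
      · have := h₀ y
        have := k₀ y
        positivity
      · simp [hT y hy, kT y hy]
      · rw [Finset.sum_add_distrib, ← Finset.mul_sum, ← Finset.mul_sum, h₁, k₁]
        linarith
      · rw [Finset.smul_sum, Finset.smul_sum, ← Finset.sum_add_distrib]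
        exact Finset.sum_congr rfl fun y _ => by rw [add_smul, mul_smul, mul_smul]
  obtain ⟨μ, h₀, hT, h₁, rfl⟩ := hsub hx'
  have hT' : ∀ y, μ y ≠ 0 → y ∈ T := fun y hy => by_contra fun h => hy (hT y h)
  -- The weights live on N(x') for some other center x'. That set has width at most 1, so the
  -- support also lies in the neighborhood of the represented point.
  refine ⟨μ, mem_localCoefficients_of_supported_in_box h₀ hT h₁ fun y y' hy hy' i => ?_,
    fun y hy => (Finset.mem_filter.1 (hT' y hy)).2⟩
  have hyN := Fintype.mem_piFinset.1 (Finset.mem_filter.1 (hT' y hy)).1 i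
  have hyN' := Fintype.mem_piFinset.1 (Finset.mem_filter.1 (hT' y' hy')).1 i
  rw [Finset.mem_Icc] at hyN hyN'
  have := Int.ceil_le_floor_add_one (x' i)
  rw [abs_le]
  omega

theorem localConvexExtension_toReal_le {f : (Fin n → ℤ) → EReal} (y : Fin n → ℤ) :
    localConvexExtension f (toReal y) ≤ f y := by
  classical
  have hy : y ∈ integralNeighborhood (toReal y) := by
    simp [mem_integralNeighborhood, toReal]
  refine (iInf₂_le (fun z => if z = y then 1 else 0) ⟨fun z _ => by positivity, ?_, ?_⟩).trans ?_
  · rw [Finset.sum_eq_single y (fun z _ hz => by simp [hz]) (fun h => absurd hy h)]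
    simp
  · simp [hy]
  · simp [hy]

/-- The set {f̃ < ⊤} is convex and contains the domain, hence its hull; weights witnessing f̃(x) < ⊤
place x in the hull of the domain points in N(x). -/
theorem IsIntegrallyConvexFun.isIntegrallyConvexSet {f : (Fin n → ℤ) → EReal}
    (hf : IsIntegrallyConvexFun f) (hbot : ∀ z, f z ≠ ⊥) (hdom : (effectiveDomain f).Nonempty) :
    IsIntegrallyConvexSet (effectiveDomain f) := by
  classical
  refine ⟨hdom, subset_antisymm ?_ (Set.iUnion_subset fun x =>
    convexHull_mono (Set.image_mono Set.inter_subset_left))⟩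
  have hconv : Convex ℝ {x | localConvexExtension f x < ⊤} := by
    refine convex_iff_forall_pos.2 fun x hx y hy a b ha hb hab => ?_
    refine (hf x y a b ha hb hab).trans_lt (EReal.add_lt_top ?_ ?_)
    · rw [← EReal.coe_toReal (ne_of_lt hx) (localConvexExtension_ne_bot hbot x), ← EReal.coe_mul]
      exact EReal.coe_ne_top _
    · rw [← EReal.coe_toReal (ne_of_lt hy) (localConvexExtension_ne_bot hbot y), ← EReal.coe_mul]
      exact EReal.coe_ne_top _
  have hsub : convexHull ℝ (toReal '' effectiveDomain f) ⊆ {x | localConvexExtension f x < ⊤} :=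
    convexHull_min (by
      rintro _ ⟨y, hy, rfl⟩
      exact (localConvexExtension_toReal_le y).trans_lt hy) hconv
  intro x hx
  obtain ⟨w, h₀, hs, h₁, hwx, -⟩ := exists_weights_of_localConvexExtension_lt hbot (hsub hx)
  refine Set.mem_iUnion.2 ⟨x, ?_⟩
  have hs' : ∀ y, w y ≠ 0 → y ∈ (integralNeighborhood x).filter (· ∈ effectiveDomain f) :=
    fun y hy => Finset.mem_filter.2 (hs y hy)
  rw [sum_eq_sum_of_support (fun y hy => (hs y hy).1) hs'] at h₁
  rw [sum_eq_sum_of_support (fun y hy => (hs y (left_ne_zero_of_smul hy)).1)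
    (fun y hy => hs' y (left_ne_zero_of_smul hy))] at hwx
  rw [← hwx]
  refine (convex_convexHull ℝ _).sum_mem (fun y _ => h₀ y) h₁ fun y hy => subset_convexHull ℝ _ ?_
  obtain ⟨hyN, hyS⟩ := Finset.mem_filter.1 hy
  rw [hwx]
  exact ⟨y, ⟨hyS, hyN⟩, rfl⟩

/-! ### Midpoint inequalities -/

theorem EReal_half_add_half (x : EReal) :
    ((1 / 2 : ℝ) : EReal) * x + ((1 / 2 : ℝ) : EReal) * x = x := by
  induction x with
  | bot => rw [EReal.coe_mul_bot_of_pos (by norm_num)]; rfl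
  | top => rw [EReal.coe_mul_top_of_pos (by norm_num)]; rfl
  | coe x => rw [← EReal.coe_mul, ← EReal.coe_add]; congr 1; ring

theorem EReal_add_le_add_of_half {a b c d : EReal} (hc : c ≠ ⊥) (hd : d ≠ ⊥) (ha : a ≠ ⊥)
    (hb : b ≠ ⊥)
    (h : ((1 / 2 : ℝ) : EReal) * a + ((1 / 2 : ℝ) : EReal) * b ≤
      ((1 / 2 : ℝ) : EReal) * c + ((1 / 2 : ℝ) : EReal) * d) : a + b ≤ c + d := by
  have hdouble : ∀ x y : EReal, x ≠ ⊥ → y ≠ ⊥ →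
      ((2 : ℝ) : EReal) * (((1 / 2 : ℝ) : EReal) * x + ((1 / 2 : ℝ) : EReal) * y) = x + y := by
    intro x y hx hy
    induction x with
    | bot => exact absurd rfl hx
    | top =>
      rw [EReal.coe_mul_top_of_pos (by norm_num), EReal.top_add_of_ne_bot hy,
        EReal.top_add_of_ne_bot (coe_mul_ne_bot (by norm_num) hy),
        EReal.coe_mul_top_of_pos (by norm_num)]
    | coe x =>
      induction y with
      | bot => exact absurd rfl hy
      | top =>
        rw [EReal.coe_mul_top_of_pos (by norm_num), ← EReal.coe_mul, EReal.coe_add_top,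
          EReal.coe_add_top, EReal.coe_mul_top_of_pos (by norm_num)]
      | coe y =>
        rw [← EReal.coe_mul, ← EReal.coe_mul, ← EReal.coe_add, ← EReal.coe_mul, ← EReal.coe_add]
        congr 1
        ring
  rw [← hdouble a b ha hb, ← hdouble c d hc hd]
  exact mul_le_mul_of_nonneg_left h (EReal.coe_nonneg.2 (by norm_num))

theorem integralNeighborhood_toReal (p : Fin n → ℤ) : integralNeighborhood (toReal p) = {p} := by
  ext t
  rw [mem_integralNeighborhood, Finset.mem_singleton]
  constructor
  · intro h
    ext i
    have hi : |p i - t i| < 1 := by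
      have := h i
      simp only [toReal] at this
      exact_mod_cast this
    rw [abs_lt] at hi
    omega
  · rintro rfl i
    simp [toReal]

theorem le_localConvexExtension_toReal (f : (Fin n → ℤ) → EReal) (p : Fin n → ℤ) :
    f p ≤ localConvexExtension f (toReal p) := by
  refine le_iInf₂ fun w hw => ?_
  have h₁ := hw.2.1
  rw [integralNeighborhood_toReal, Finset.sum_singleton] at h₁ ⊢
  rw [h₁, EReal.coe_one, one_mul]

/-- The neighborhood of the midpoint consists of the two endpoints alone, and coordinate j then
forces both weights to be 1/2. -/
theorem le_localConvexExtension_edge_midpoint (f : (Fin n → ℤ) → EReal) (p : Fin n → ℤ)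
    (j : Fin n) :
    ((1 / 2 : ℝ) : EReal) * f p + ((1 / 2 : ℝ) : EReal) * f (p + Pi.single j 1) ≤
      localConvexExtension f
        ((1 / 2 : ℝ) • toReal p + (1 / 2 : ℝ) • toReal (p + Pi.single j 1)) := by
  classical
  set q := p + Pi.single j 1 with hq
  have hqj : q j = p j + 1 := by simp [hq]
  have hqi : ∀ i, i ≠ j → q i = p i := fun i hi => by simp [hq, hi]
  have hne : p ≠ q := fun h => by
    rw [← h] at hqj
    omega
  have hN : integralNeighborhood ((1 / 2 : ℝ) • toReal p + (1 / 2 : ℝ) • toReal q) = {p, q} := by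
    ext t
    simp only [mem_integralNeighborhood, Finset.mem_insert, Finset.mem_singleton, Pi.add_apply,
      Pi.smul_apply, smul_eq_mul, toReal]
    constructor
    · intro h
      have hti : ∀ i, i ≠ j → t i = p i := fun i hi => by
        have hi' := h i
        rw [hqi i hi, abs_lt] at hi'
        have i₁ : p i - t i < 1 := by
          have : (p i : ℝ) - t i < 1 := by linarith [hi'.2]
          exact_mod_cast this
        have i₂ : -1 < p i - t i := by
          have : (-1 : ℝ) < (p i : ℝ) - t i := by linarith [hi'.1]
          exact_mod_cast this
        omega
      have hj := h j
      rw [hqj, abs_lt] at hj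
      push_cast at hj
      have i₁ : 2 * p j + 1 - 2 * t j < 2 := by
        have : 2 * (p j : ℝ) + 1 - 2 * t j < 2 := by linarith [hj.2]
        exact_mod_cast this
      have i₂ : -2 < 2 * p j + 1 - 2 * t j := by
        have : (-2 : ℝ) < 2 * (p j : ℝ) + 1 - 2 * t j := by linarith [hj.1]
        exact_mod_cast this
      rcases (by omega : t j = p j ∨ t j = p j + 1) with htj | htj
      · left
        ext i
        rcases eq_or_ne i j with rfl | hi
        · exact htj
        · exact hti i hi
      · right
        ext i
        rcases eq_or_ne i j with rfl | hi
        · rw [htj, hqj]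
        · rw [hti i hi, hqi i hi]
    · have key : ∀ i, |(q i : ℝ) - p i| ≤ 1 := fun i => by
        rcases eq_or_ne i j with rfl | hi
        · rw [hqj]
          simp
        · rw [hqi i hi]
          simp
      rintro (rfl | rfl) i
      · have := abs_le.1 (key i)
        rw [abs_lt]
        constructor <;> linarith [this.1, this.2]
      · have := abs_le.1 (key i)
        rw [abs_lt]
        constructor <;> linarith [this.1, this.2]
  refine le_iInf₂ fun w hw => ?_
  have h₁ := hw.2.1
  have hx := congrFun hw.2.2 j
  rw [hN, Finset.sum_pair hne] at h₁ hx ⊢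
  simp only [Pi.add_apply, Pi.smul_apply, smul_eq_mul, toReal, hqj] at hx
  push_cast at hx
  have hwq : w q = 1 / 2 := by linear_combination hx - (p j : ℝ) * h₁
  have hwp : w p = 1 / 2 := by linarith
  rw [hwp, hwq]

theorem IsIntegrallyConvexFun.localConvexExtension_midpoint_le {f : (Fin n → ℤ) → EReal}
    (hf : IsIntegrallyConvexFun f) (y y' : Fin n → ℤ) :
    localConvexExtension f ((1 / 2 : ℝ) • toReal y + (1 / 2 : ℝ) • toReal y') ≤
      ((1 / 2 : ℝ) : EReal) * f y + ((1 / 2 : ℝ) : EReal) * f y' :=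
  (hf _ _ (1 / 2) (1 / 2) (by norm_num) (by norm_num) (by norm_num)).trans
    (add_le_add
      (mul_le_mul_of_nonneg_left (localConvexExtension_toReal_le y)
        (EReal.coe_nonneg.2 (by norm_num)))
      (mul_le_mul_of_nonneg_left (localConvexExtension_toReal_le y')
        (EReal.coe_nonneg.2 (by norm_num))))

theorem midpoint_congr {y y' p q : Fin n → ℤ} (h : y + y' = p + q) :
    (1 / 2 : ℝ) • toReal y + (1 / 2 : ℝ) • toReal y' =
      (1 / 2 : ℝ) • toReal p + (1 / 2 : ℝ) • toReal q := by
  ext i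
  have hi : (y i + y' i : ℝ) = p i + q i := by exact_mod_cast congrFun h i
  simp only [Pi.add_apply, Pi.smul_apply, smul_eq_mul, toReal]
  linear_combination hi / 2

theorem IsIntegrallyConvexFun.two_mul_le {f : (Fin n → ℤ) → EReal}
    (hf : IsIntegrallyConvexFun f) (hbot : ∀ z, f z ≠ ⊥) {y y' p : Fin n → ℤ}
    (h : y + y' = p + p) : 2 * f p ≤ f y + f y' := by
  rw [EReal_two_mul]
  refine EReal_add_le_add_of_half (hbot _) (hbot _) (hbot _) (hbot _) ?_
  rw [EReal_half_add_half]
  refine le_trans ?_ (hf.localConvexExtension_midpoint_le y y')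
  rw [midpoint_congr h, ← add_smul]
  norm_num
  exact le_localConvexExtension_toReal f p

theorem IsIntegrallyConvexFun.add_le_of_edge {f : (Fin n → ℤ) → EReal}
    (hf : IsIntegrallyConvexFun f) (hbot : ∀ z, f z ≠ ⊥) {y y' p q : Fin n → ℤ} (j : Fin n)
    (hq : q = p + Pi.single j 1) (h : y + y' = p + q) : f q + f p ≤ f y + f y' := by
  subst hq
  rw [add_comm (f _)]
  refine EReal_add_le_add_of_half (hbot _) (hbot _) (hbot _) (hbot _) ?_
  refine le_trans ?_ (hf.localConvexExtension_midpoint_le y y')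
  rw [midpoint_congr h]
  exact le_localConvexExtension_edge_midpoint f p j

/-! ### Edges crossed by a segment between points of the set -/

/-- The segment from `y` to `y + m e + k d`, where `e` and `d` are signed unit vectors, leaves `y`
through the edge joining `y + e` to `y + e + d`. -/
theorem IsIntegrallyConvexSet.edge_mem {S : Set (Fin n → ℤ)} (hS : IsIntegrallyConvexSet S)
    {i j : Fin n} (hij : i ≠ j) (ε : ℤ) {δ : ℤ} (hδ : δ = 1 ∨ δ = -1) {m k : ℕ} (hm : 0 < m)
    (hk : k ≤ m) {y : Fin n → ℤ} (hy : y ∈ S)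
    (hy' : y + m • Pi.single i ε + k • Pi.single j δ ∈ S) :
    (k < m → y + Pi.single i ε ∈ S) ∧ (0 < k → y + Pi.single i ε + Pi.single j δ ∈ S) := by
  classical
  set u : Fin n → ℤ := Pi.single i ε with hu
  set v : Fin n → ℤ := Pi.single j δ with hv
  have hm' : (0 : ℝ) < m := by exact_mod_cast hm
  set κ : ℝ := (k : ℝ) / m with hκ
  have hκ₀ : 0 ≤ κ := by positivity
  have hκ₁ : κ ≤ 1 := (div_le_one hm').2 (by exact_mod_cast hk)
  -- The point at parameter 1/m on the segment; it lies on the edge from y + u to y + u + v, at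
  -- ratio κ = k/m.
  set x : Fin n → ℝ := toReal y + toReal u + κ • toReal v with hx
  have hxS : x ∈ convexHull ℝ (toReal '' S) := by
    have hxy : x = (1 - 1 / (m : ℝ)) • toReal y + (1 / (m : ℝ)) • toReal (y + m • u + k • v) := by
      ext l
      simp only [hx, hκ, toReal, Pi.add_apply, Pi.smul_apply, smul_eq_mul]
      simp only [nsmul_eq_mul]
      push_cast
      field_simp
      ring
    rw [hxy]
    refine convex_convexHull ℝ _ (subset_convexHull ℝ _ (Set.mem_image_of_mem _ hy))
      (subset_convexHull ℝ _ (Set.mem_image_of_mem _ hy')) ?_ (by positivity) (by ring)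
    rw [sub_nonneg, div_le_one hm']
    exact_mod_cast hm
  obtain ⟨w, hw, hwS⟩ := hS.exists_localCoefficients hxS
  have hvj : v j = δ := by simp [hv]
  have huj : u j = 0 := by simp [hu, hij.symm]
  have hxj : x j = y j + κ * δ := by simp [hx, toReal, hvj, huj]
  have hN : ∀ t ∈ integralNeighborhood x, t = y + u ∨ t = y + u + v := by
    intro t ht
    rw [mem_integralNeighborhood] at ht
    have htl : ∀ l, l ≠ j → t l = y l + u l := fun l hl => by
      have hl' := ht l
      have hxl : x l = y l + u l := by simp [hx, toReal, hv, hl]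
      rw [hxl] at hl'
      have : |y l + u l - t l| < 1 := by exact_mod_cast hl'
      rw [abs_lt] at this
      omega
    have hj := ht j
    rw [hxj, abs_lt] at hj
    have htj : t j = y j ∨ t j = y j + δ := by
      rcases hδ with rfl | rfl
      · have i₁ : y j - t j < 1 := by
          have : (y j : ℝ) - t j < 1 := by push_cast at hj; linarith [hj.2]
          exact_mod_cast this
        have i₂ : -2 < y j - t j := by
          have : (-2 : ℝ) < (y j : ℝ) - t j := by push_cast at hj; linarith [hj.1]
          exact_mod_cast this
        omega
      · have i₁ : y j - t j < 2 := by
          have : (y j : ℝ) - t j < 2 := by push_cast at hj; linarith [hj.2]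
          exact_mod_cast this
        have i₂ : -1 < y j - t j := by
          have : (-1 : ℝ) < (y j : ℝ) - t j := by push_cast at hj; linarith [hj.1]
          exact_mod_cast this
        omega
    refine htj.imp (fun h => ?_) fun h => ?_ <;> ext l <;> rcases eq_or_ne l j with rfl | hl
    · simp [h, huj]
    · simp [htl l hl]
    · simp [h, huj, hvj]
    · simp [htl l hl, hv, hl]
  -- If one endpoint of the edge is missing from S, all weight sits on the other, so x is that
  -- endpoint in coordinate j; this makes κ equal to 1 or 0.
  have hsum : ∀ c : ℤ, (∀ t ∈ integralNeighborhood x, w t ≠ 0 → t j = c) → x j = c := by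
    intro c hc
    rw [← congrFun hw.2.2 j, Finset.sum_apply, ← one_mul (c : ℝ), ← hw.2.1, Finset.sum_mul]
    refine Finset.sum_congr rfl fun t ht => ?_
    rcases eq_or_ne (w t) 0 with h | h
    · simp [h]
    · simp [toReal, hc t ht h]
  have hδ' : (δ : ℝ) ≠ 0 := by rcases hδ with rfl | rfl <;> simp
  constructor
  · intro hkm
    by_contra hmem
    have h := hsum (y j + δ) fun t ht hwt => by
      rcases hN t ht with rfl | rfl
      · exact absurd (hwS _ hwt) hmem
      · simp [huj, hvj]
    rw [hxj] at h
    push_cast at h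
    have : κ = 1 := mul_right_cancel₀ hδ' (by linarith)
    rw [hκ, div_eq_one_iff_eq hm'.ne'] at this
    exact hkm.ne (by exact_mod_cast this)
  · intro hk₀
    by_contra hmem
    have h := hsum (y j) fun t ht hwt => by
      rcases hN t ht with rfl | rfl
      · simp [huj]
      · exact absurd (hwS _ hwt) hmem
    rw [hxj] at h
    have : κ * δ = 0 := by linarith
    have hk' : (0 : ℝ) < k := by exact_mod_cast hk₀
    have : κ ≠ 0 := by positivity
    simp_all

/-! ### The five inequalities as moves -/

section Moves

/-- Every pair of points of `S` with difference `d` can be exchanged for the pair at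
displacements `p` and `q` from its first point. -/
def ExchangesAlong {G : Type*} [AddCommGroup G] (S : Set G) (F : G → ℝ) (d p q : G) : Prop :=
  ∀ z, ExchangeLE S F z (z + d) (z + p) (z + q)

variable {G : Type*} [AddCommGroup G] {S : Set G} {F : G → ℝ} {d p q d' p' q' : G}

theorem ExchangesAlong.congr (h : ExchangesAlong S F d p q) (hd : d = d') (hp : p = p')
    (hq : q = q') : ExchangesAlong S F d' p' q' := by
  subst hd hp hq
  exact h

/-- The same exchange read from the other end of the pair; the condition p + q = d makes the two
targets trade places. -/
theorem ExchangesAlong.neg (h : ExchangesAlong S F d p q) (hpq : p + q = d) :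
    ExchangesAlong S F (-d) (-p) (-q) := by
  subst hpq
  intro z hz hz'
  have := h (z + -(p + q)) hz' (by rwa [neg_add_cancel_right])
  have e₁ : z + -(p + q) + p = z + -q := by abel
  have e₂ : z + -(p + q) + q = z + -p := by abel
  have e₃ : z + -(p + q) + (p + q) = z := by abel
  rw [e₁, e₂, e₃] at this
  exact ⟨this.2.1, this.1, by linarith [this.2.2]⟩

theorem ExchangesAlong.comm (h : ExchangesAlong S F d p q) : ExchangesAlong S F d q p :=
  fun z hz hz' => by
    obtain ⟨hp, hq, hpq⟩ := h z hz hz'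
    exact ⟨hq, hp, by linarith⟩

/-- The right side is finite on the domain, and with ⊥ excluded this makes both terms on the left
finite. Thus one `EReal` inequality carries both the membership and the real inequality. -/
theorem exchangesAlong_of_add_le {n : ℕ} {f : (Fin n → ℤ) → EReal} (hbot : ∀ z, f z ≠ ⊥)
    {d p q : Fin n → ℤ}
    (h : ∀ z ∈ effectiveDomain f, f (z + p) + f (z + q) ≤ f z + f (z + d)) :
    ExchangesAlong (effectiveDomain f) (fun y => (f y).toReal) d p q := by
  intro z hz hz'
  have hle := h z hz
  have hlt := hle.trans_lt (EReal.add_lt_top hz.ne hz'.ne)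
  obtain ⟨hp, hq⟩ := (EReal.add_ne_top_iff_ne_top₂ (hbot _) (hbot _)).1 hlt.ne
  refine ⟨hp.lt_top, hq.lt_top, ?_⟩
  rw [← EReal.coe_toReal hp (hbot _), ← EReal.coe_toReal hq (hbot _),
    ← EReal.coe_toReal hz.ne (hbot _), ← EReal.coe_toReal hz'.ne (hbot _), ← EReal.coe_add,
    ← EReal.coe_add, EReal.coe_le_coe_iff] at hle
  exact hle

/-- Every choice of axis and signs reduces to a listed inequality, possibly swapped or read
backwards. The swapped versions of the two diagonal inequalities add nothing: they are `a₄` itself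
and the negative of `a₅`. -/
theorem exchangesAlong_of_fiveInequalities {f : (Fin 2 → ℤ) → EReal} (hbot : ∀ z, f z ≠ ⊥)
    (hf : ∀ z ∈ effectiveDomain f,
      FiveInequalities (shiftBy f z) ∧ FiveInequalities (swapCoordinates (shiftBy f z)))
    {i j : Fin 2} (hij : i ≠ j) {ε δ : ℤ} (hε : ε = 1 ∨ ε = -1) (hδ : δ = 1 ∨ δ = -1) :
    let u : Fin 2 → ℤ := Pi.single i ε
    let v : Fin 2 → ℤ := Pi.single j δ
    let E := ExchangesAlong (effectiveDomain f) (fun y => (f y).toReal)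
    E (2 • u) u u ∧ E (2 • u + v) u (u + v) ∧ E (2 • (u + v)) (u + v) (u + v) := by
  intro u v E
  have hzero : ∀ z : Fin 2 → ℤ, z + ![0, 0] = z := fun z => by
    ext l
    fin_cases l <;> simp
  simp only [FiveInequalities, swapCoordinates, shiftBy, EReal_two_mul, hzero, ge_iff_le,
    Matrix.cons_val_zero, Matrix.cons_val_one] at hf
  have a₁ : E ![2, 1] ![1, 1] ![1, 0] := exchangesAlong_of_add_le hbot fun z hz => (hf z hz).1.1
  have a₂ : E ![2, -1] ![1, -1] ![1, 0] :=
    exchangesAlong_of_add_le hbot fun z hz => (hf z hz).1.2.1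
  have a₃ : E ![2, 0] ![1, 0] ![1, 0] :=
    exchangesAlong_of_add_le hbot fun z hz => (hf z hz).1.2.2.1
  have a₄ : E ![2, 2] ![1, 1] ![1, 1] :=
    exchangesAlong_of_add_le hbot fun z hz => (hf z hz).1.2.2.2.1
  have a₅ : E ![2, -2] ![1, -1] ![1, -1] :=
    exchangesAlong_of_add_le hbot fun z hz => (hf z hz).1.2.2.2.2
  have b₁ : E ![1, 2] ![1, 1] ![0, 1] := exchangesAlong_of_add_le hbot fun z hz => (hf z hz).2.1
  have b₂ : E ![-1, 2] ![-1, 1] ![0, 1] :=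
    exchangesAlong_of_add_le hbot fun z hz => (hf z hz).2.2.1
  have b₃ : E ![0, 2] ![0, 1] ![0, 1] :=
    exchangesAlong_of_add_le hbot fun z hz => (hf z hz).2.2.2.1
  have hunit : E (2 • u) u u := by
    fin_cases i <;> rcases hε with rfl | rfl
    · exact a₃.congr (by decide) (by decide) (by decide)
    · exact (a₃.neg (by decide)).congr (by decide) (by decide) (by decide)
    · exact b₃.congr (by decide) (by decide) (by decide)
    · exact (b₃.neg (by decide)).congr (by decide) (by decide) (by decide)
  have hj : j = 1 - i := (by decide : ∀ i j : Fin 2, i ≠ j → j = 1 - i) i j hij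
  subst hj
  refine ⟨hunit, ?_, ?_⟩ <;>
    fin_cases i <;> rcases hε with rfl | rfl <;> rcases hδ with rfl | rfl
  · exact a₁.comm.congr (by decide) (by decide) (by decide)
  · exact a₂.comm.congr (by decide) (by decide) (by decide)
  · exact (a₂.comm.neg (by decide)).congr (by decide) (by decide) (by decide)
  · exact (a₁.comm.neg (by decide)).congr (by decide) (by decide) (by decide)
  · exact b₁.comm.congr (by decide) (by decide) (by decide)
  · exact b₂.comm.congr (by decide) (by decide) (by decide)
  · exact (b₂.comm.neg (by decide)).congr (by decide) (by decide) (by decide)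
  · exact (b₁.comm.neg (by decide)).congr (by decide) (by decide) (by decide)
  · exact a₄.congr (by decide) (by decide) (by decide)
  · exact a₅.congr (by decide) (by decide) (by decide)
  · exact (a₅.neg (by decide)).congr (by decide) (by decide) (by decide)
  · exact (a₄.neg (by decide)).congr (by decide) (by decide) (by decide)
  · exact a₄.congr (by decide) (by decide) (by decide)
  · exact (a₅.neg (by decide)).congr (by decide) (by decide) (by decide)
  · exact a₅.congr (by decide) (by decide) (by decide)
  · exact (a₄.neg (by decide)).congr (by decide) (by decide) (by decide)

end Moves

/-! ### The two directions in the plane -/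

theorem IsIntegrallyConvexFun.fiveInequalities {f : (Fin 2 → ℤ) → EReal}
    (hf : IsIntegrallyConvexFun f) (hbot : ∀ z, f z ≠ ⊥) (z : Fin 2 → ℤ) :
    FiveInequalities (shiftBy f z) ∧ FiveInequalities (swapCoordinates (shiftBy f z)) := by
  have hsum : ∀ a b c d : Fin 2 → ℤ, a + b = c + d → z + a + (z + b) = z + c + (z + d) :=
    fun a b c d h => by rw [add_add_add_comm, h, add_add_add_comm]
  have hedge : ∀ (a b : Fin 2 → ℤ) (j : Fin 2), a = b + Pi.single j 1 →
      z + a = z + b + Pi.single j 1 := fun a b j h => by rw [h, add_assoc]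
  refine ⟨⟨?_, ?_, ?_, ?_, ?_⟩, ⟨?_, ?_, ?_, ?_, ?_⟩⟩
  · exact hf.add_le_of_edge hbot 1 (hedge _ _ 1 (by decide)) (hsum _ _ _ _ (by decide))
  · rw [add_comm (shiftBy f z ![1, -1])]
    exact hf.add_le_of_edge hbot 1 (hedge _ _ 1 (by decide)) (hsum _ _ _ _ (by decide))
  · exact hf.two_mul_le hbot (hsum _ _ _ _ (by decide))
  · exact hf.two_mul_le hbot (hsum _ _ _ _ (by decide))
  · exact hf.two_mul_le hbot (hsum _ _ _ _ (by decide))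
  · exact hf.add_le_of_edge hbot 0 (hedge _ _ 0 (by decide)) (hsum _ _ _ _ (by decide))
  · rw [add_comm (swapCoordinates (shiftBy f z) ![1, -1])]
    exact hf.add_le_of_edge hbot 0 (hedge _ _ 0 (by decide)) (hsum _ _ _ _ (by decide))
  · exact hf.two_mul_le hbot (hsum _ _ _ _ (by decide))
  · exact hf.two_mul_le hbot (hsum _ _ _ _ (by decide))
  · exact hf.two_mul_le hbot (hsum _ _ _ _ (by decide))

theorem exists_exchange_of_fiveInequalities {f : (Fin 2 → ℤ) → EReal} (hbot : ∀ z, f z ≠ ⊥)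
    (hS : IsIntegrallyConvexSet (effectiveDomain f))
    (hf : ∀ z ∈ effectiveDomain f,
      FiveInequalities (shiftBy f z) ∧ FiveInequalities (swapCoordinates (shiftBy f z)))
    {y y' : Fin 2 → ℤ} (hfar : ∃ i, 2 ≤ |y i - y' i|) (hy : y ∈ effectiveDomain f)
    (hy' : y' ∈ effectiveDomain f) :
    ∃ p ∈ Finset.uIcc y y', ∃ q ∈ Finset.uIcc y y', p + q = y + y' ∧
      sqNorm p + sqNorm q < sqNorm y + sqNorm y' ∧
      p ∈ effectiveDomain f ∧ q ∈ effectiveDomain f ∧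
      (f p).toReal + (f q).toReal ≤ (f y).toReal + (f y').toReal := by
  -- Coordinate i is a dominant one; its gap is at least 2 and is later written m + 2.
  obtain ⟨i, j, hij, hlarge, hle⟩ : ∃ i j : Fin 2, i ≠ j ∧ 2 ≤ |y' i - y i| ∧
      |y' j - y j| ≤ |y' i - y i| := by
    obtain ⟨l, hl⟩ := hfar
    have hl' : 2 ≤ |y' 0 - y 0| ∨ 2 ≤ |y' 1 - y 1| := by
      fin_cases l
      · left
        rwa [abs_sub_comm]
      · right
        rwa [abs_sub_comm]
    rcases le_total |y' 1 - y 1| |y' 0 - y 0| with h | h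
    · exact ⟨0, 1, by decide, hl'.elim id fun h' => h'.trans h, h⟩
    · exact ⟨1, 0, by decide, hl'.elim (fun h' => h'.trans h) id, h⟩
  have hsign : ∀ a : ℤ, ∃ ε : ℤ, (ε = 1 ∨ ε = -1) ∧ a = (a.natAbs : ℤ) * ε := fun a => by
    rcases le_total 0 a with h | h
    · exact ⟨1, Or.inl rfl, by omega⟩
    · exact ⟨-1, Or.inr rfl, by omega⟩
  obtain ⟨ε, hε, hi⟩ := hsign (y' i - y i)
  obtain ⟨δ, hδ, hj⟩ := hsign (y' j - y j)
  obtain ⟨m, hm⟩ : ∃ m, (y' i - y i).natAbs = m + 2 := ⟨(y' i - y i).natAbs - 2, by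
    rw [Int.abs_eq_natAbs] at hlarge
    omega⟩
  obtain ⟨k, hk⟩ : ∃ k, (y' j - y j).natAbs = k := ⟨_, rfl⟩
  rw [hm] at hi
  rw [hk] at hj
  have hkm : k ≤ m + 2 := by
    rw [← hm, ← hk]
    rw [Int.abs_eq_natAbs, Int.abs_eq_natAbs] at hle
    exact_mod_cast hle
  clear hm hk hlarge hle hfar
  obtain ⟨h₁, h₂, h₃⟩ := exchangesAlong_of_fiveInequalities hbot hf hij hε hδ
  set u : Fin 2 → ℤ := Pi.single i ε with hu
  set v : Fin 2 → ℤ := Pi.single j δ with hv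
  have hui : u i = ε := by simp [hu]
  have huj : u j = 0 := by simp [hu, hij.symm]
  have hvi : v i = 0 := by simp [hv, hij]
  have hvj : v j = δ := by simp [hv]
  have hcover : ∀ l, l = i ∨ l = j := fun l =>
    (by decide : ∀ i j l : Fin 2, i ≠ j → l = i ∨ l = j) i j l hij
  have hnorm : ∀ z : Fin 2 → ℤ, sqNorm z = z i ^ 2 + z j ^ 2 := fun z => by
    rw [sqNorm, ← Finset.sum_pair (f := fun l => z l ^ 2) hij]
    exact Finset.sum_congr (by ext l; simpa using hcover l) fun _ _ => rfl
  have hbetween : ∀ z : Fin 2 → ℤ, (y i ≤ z i ∧ z i ≤ y' i ∨ y' i ≤ z i ∧ z i ≤ y i) →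
      (y j ≤ z j ∧ z j ≤ y' j ∨ y' j ≤ z j ∧ z j ≤ y j) → z ∈ Finset.uIcc y y' := by
    intro z hzi hzj
    rw [Finset.mem_uIcc, Pi.le_def, Pi.le_def]
    refine ⟨fun l => ?_, fun l => ?_⟩ <;> rcases hcover l with rfl | rfl <;>
      simp only [Pi.inf_apply, Pi.sup_apply] <;> omega
  have e : y' = y + (m + 2) • u + k • v := by
    ext l
    rcases hcover l with rfl | rfl
    · simp [hui, hvi]
      push_cast at hi
      linarith
    · simp [huj, hvj]
      linarith
  push_cast at hi
  -- Replacing y, y' by y + s, y' - s lowers the sum of squared norms by 2⟨s, y' - y - s⟩. This is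
  -- 2(m + 1) for s = u, and 2(m + 1) + 2(k - 1) for s = u + v, where k ≥ 1 is needed.
  have hclose : ∀ p q, p + q = y + y' → p i = y i + ε →
      (p j = y j ∨ p j = y j + δ ∧ 1 ≤ k) → p ∈ Finset.uIcc y y' ∧ q ∈ Finset.uIcc y y' ∧
        sqNorm p + sqNorm q < sqNorm y + sqNorm y' := by
    intro p q hpq hpi hpj
    have hqi : q i = y i + (m + 1) * ε := by
      have := congrFun hpq i
      simp only [Pi.add_apply] at this
      linarith
    have hqj : p j + q j = y j + y' j := congrFun hpq j
    refine ⟨hbetween p ?_ ?_, hbetween q ?_ ?_, ?_⟩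
    · rcases hε with rfl | rfl <;> omega
    · rcases hδ with rfl | rfl <;> omega
    · rcases hε with rfl | rfl <;> omega
    · rcases hδ with rfl | rfl <;> omega
    · have hi' : y' i = y i + (m + 2) * ε := by linarith
      have hj' : y' j = y j + k * δ := by linarith
      have hqj' : q j = y j + y' j - p j := by linarith
      rw [hnorm, hnorm, hnorm, hnorm, hqj', hqi, hpi, hi', hj']
      rcases hpj with h | ⟨h, hk₁⟩
      · rw [h]
        rcases hε with rfl | rfl <;> linarith
      · rw [h]
        have hk₁' : (1 : ℤ) ≤ k := by exact_mod_cast hk₁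
        rcases hε with rfl | rfl <;> rcases hδ with rfl | rfl <;> linarith
  have d₁ : ∀ y (m k : ℕ), k < m → y ∈ effectiveDomain f → y + m • u + k • v ∈ effectiveDomain f →
      y + u ∈ effectiveDomain f := fun y m k hkm hy hy' =>
    (hS.edge_mem hij ε hδ (by omega) hkm.le hy hy').1 hkm
  have d₂ : ∀ y (m k : ℕ), 0 < k → k ≤ m → y ∈ effectiveDomain f →
      y + m • u + k • v ∈ effectiveDomain f → y + u + v ∈ effectiveDomain f :=
    fun y m k hk hkm hy hy' => (hS.edge_mem hij ε hδ (by omega) hkm hy hy').2 hk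
  -- When k = m + 2 the segment is diagonal and `d₁` no longer gives y + u in the domain; only y + u
  -- + v is guaranteed, so the step is u + v.
  rcases hkm.lt_or_eq with hlt | rfl
  · have hex := exchangeLE_step h₁ (fun y => by simpa only [add_assoc] using h₂ y) d₁ d₂ m k y
      (by omega)
    rw [← e] at hex
    obtain ⟨hp, hq, hF⟩ := hex hy hy'
    have hsum : y + u + (y + (m + 1) • u + k • v) = y + y' := by rw [e]; module
    obtain ⟨hpI, hqI, hQ⟩ := hclose _ _ hsum (by simp [hui]) (Or.inl (by simp [huj]))
    exact ⟨_, hpI, _, hqI, hsum, hQ, hp, hq, hF⟩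
  · have e' : y' = y + (m + 2) • (u + v) := by rw [e, smul_add, add_assoc]
    have hex := exchangeLE_step_diagonal h₃ (fun y m hm hy hy' => by
      rw [← add_assoc]
      exact d₂ y m m hm le_rfl hy (by rwa [smul_add, ← add_assoc] at hy')) m y
    rw [← e'] at hex
    obtain ⟨hp, hq, hF⟩ := hex hy hy'
    have hsum : y + (u + v) + (y + (m + 1) • (u + v)) = y + y' := by rw [e']; module
    obtain ⟨hpI, hqI, hQ⟩ := hclose _ _ hsum (by simp [hui, hvi])
      (Or.inr ⟨by simp [huj, hvj], by omega⟩)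
    exact ⟨_, hpI, _, hqI, hsum, hQ, hp, hq, hF⟩

end IntegralConvexity

theorem theorem3p3 (f : (Fin 2 → ℤ) → EReal) (hbot : ∀ z, f z ≠ ⊥)
    (hdom : (IntegralConvexity.effectiveDomain f).Nonempty) :
    IntegralConvexity.IsIntegrallyConvexFun f ↔
      IntegralConvexity.IsIntegrallyConvexSet (IntegralConvexity.effectiveDomain f) ∧
      ∀ z ∈ IntegralConvexity.effectiveDomain f,
        IntegralConvexity.FiveInequalities (IntegralConvexity.shiftBy f z) ∧
        IntegralConvexity.FiveInequalities
          (IntegralConvexity.swapCoordinates (IntegralConvexity.shiftBy f z)) :=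
  ⟨fun hf => ⟨hf.isIntegrallyConvexSet hbot hdom, fun z _ => hf.fiveInequalities hbot z⟩,
    fun hf => IntegralConvexity.isIntegrallyConvexFun_of_exchange hbot fun _ _ hfar hy hy' =>
      IntegralConvexity.exists_exchange_of_fiveInequalities hbot hf.1 hf.2 hfar hy hy'⟩
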